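/- Let $\ell_2$ be the real Hilbert space of square-summable sequences, and let $F(\ell_2)$ be the set of all closed subsets of $\ell_2$ (including $\varnothing$) with the Effros $\sigma$-algebra, i.e. the one generated by the families $\{A\in F(\ell_2): A\cap U\neq\varnothing\}$, $U\subseteq\ell_2$ open. Call $N\subseteq\ell_2$ \emph{purely 1-unrectifiable} if $\mathcal H^1(N\cap f([0,1]))=0$ for every $C^1$ map $f\colon[0,1]\to\ell_2$, where $\mathcal H^1$ is the one-dimensional Hausdorff measure. A subset $A$ of a standard Borel space $X$ is $\Sigma^1_1$ if it is the projection to $X$ of a Borel subset of $X\times Y$ for some Polish space $Y$, and $\Pi^1_1$ if its complement is $\Sigma^1_1$. It is $\Pi^1_1$-hard if for every $\Pi^1_1$ subset $B$ of every Polish space $Y$ there is a Borel map $g\colon Y\to X$ with $B=g^{-1}(A)$, and $\Pi^1_1$-complete if it is both $\Pi^1_1$ and $\Pi^1_1$-hard. Let $\mathrm{Tr}$ be the space of trees on $\omega$, i.e. of the sets $T\subseteq\omega^{<\omega}$ closed under initial segments, with the Borel structure it inherits as a subset of $2^{\omega^{<\omega}}$; a branch of $T$ is a $b\in\omega^\omega$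 all of whose initial segments $b{\restriction}n$, $n\in\omega$, lie in $T$. Let $C\subset[0,1]$ be the fat Cantor set obtained by starting from $[0,1]$ and removing, at step $n=1,2,\dots$, from the middle of each of the $2^{n-1}$ remaining intervals an open interval of length $4^{-n}$. \textbf{Theorem.} $F(\ell_2)$ is a standard Borel space, and the set $P=\{A\in F(\ell_2): A\text{ is purely 1-unrectifiable}\}$ is $\Pi^1_1$-complete. Moreover, there is a Borel map $H\colon\mathrm{Tr}\to F(\ell_2)$ such that for every $T\in\mathrm{Tr}$: (a) if $T$ has no branch, then $H(T)$ is countable; (b) if $T$ has a branch, then there is a $C^1$ map $f\colon[0,1]\to\ell_2$ such that $f|_C$ is bi-Lipschitz, $f(C)\subseteq H(T)$ and $\mathcal H^1(f(C))>0$. -/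

import Mathlib

open Set MeasureTheory TopologicalSpace
open scoped ENNReal MeasureTheory

/-- The real Hilbert space of square-summable sequences. -/
abbrev Ell2 : Type := lp (fun _ : ℕ => ℝ) 2

/-- The Borel sigma-algebra of the norm topology. -/
noncomputable instance Ell2.instMeasurableSpace : MeasurableSpace Ell2 := borel Ell2

instance Ell2.instBorelSpace : BorelSpace Ell2 := ⟨rfl⟩

/-- The Effros Borel structure on the hyperspace of closed subsets of `X` (the empty set included):
the sigma-algebra generated by the families `{A | A ∩ U ≠ ∅}`, for `U` open. -/
instance effrosMeasurableSpace (X : Type*) [TopologicalSpace X] : MeasurableSpace (Closeds X) :=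
  MeasurableSpace.generateFrom
    {S | ∃ U : Set X, IsOpen U ∧ S = {A : Closeds X | ((A : Set X) ∩ U).Nonempty}}

/-- `N` is purely 1-unrectifiable: it meets the range of every `C¹` map `f : [0,1] → E`
in a set of one-dimensional Hausdorff measure zero. (Only the values of `f` on `[0,1]` matter,
and differentiability is relative to `[0,1]`.) -/
def IsPurelyUnrectifiable {E : Type*} [NormedAddCommGroup E] [NormedSpace ℝ E]
    [MeasurableSpace E] [BorelSpace E] (N : Set E) : Prop :=
  ∀ f : ℝ → E, ContDiffOn ℝ 1 f (Icc 0 1) → μH[1] (N ∩ f '' Icc 0 1) = 0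

/-- `A ⊆ X` is `Σ¹₁`: it is the projection of a Borel subset of `X × Y` for some Polish space `Y`.
To be used for standard Borel spaces `X`. -/
def IsSigma11 {X : Type*} [MeasurableSpace X] (A : Set X) : Prop :=
  ∃ (Y : Type) (_ : TopologicalSpace Y) (_ : PolishSpace Y)
    (_ : MeasurableSpace Y) (_ : BorelSpace Y) (B : Set (X × Y)),
    MeasurableSet B ∧ A = Prod.fst '' B

/-- `A ⊆ X` is `Π¹₁` (coanalytic): its complement is `Σ¹₁`. -/
def IsPi11 {X : Type*} [MeasurableSpace X] (A : Set X) : Prop :=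
  IsSigma11 Aᶜ

/-- Borel (Wadge) reducibility of `A ⊆ X` to `B ⊆ Y`. -/
def BorelReducible {X Y : Type*} [MeasurableSpace X] [MeasurableSpace Y]
    (A : Set X) (B : Set Y) : Prop :=
  ∃ f : X → Y, Measurable f ∧ ∀ x, x ∈ A ↔ f x ∈ B

/-- `A` is `Π¹₁`-hard: every `Π¹₁` subset of every Polish space is Borel reducible to `A`. -/
def IsPi11Hard {X : Type*} [MeasurableSpace X] (A : Set X) : Prop :=
  ∀ (Y : Type) [TopologicalSpace Y] [PolishSpace Y] [MeasurableSpace Y] [BorelSpace Y]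
    (B : Set Y), IsPi11 B → BorelReducible B A

/-- `A` is `Π¹₁`-complete. -/
def IsPi11Complete {X : Type*} [MeasurableSpace X] (A : Set X) : Prop :=
  IsPi11 A ∧ IsPi11Hard A

/-- The space of trees on `ω`: sets of finite sequences of natural numbers closed under initial
segments. It carries the Borel structure it inherits as a subset of the power set `2^(ω^{<ω})`. -/
abbrev Tr : Type := Descriptive.tree ℕ

/-- `T` has a branch: some `b : ω → ω` has all its initial segments `(b 0, …, b (n-1))` in `T`. -/
def HasBranch (T : Tr) : Prop :=
  ∃ b : ℕ → ℕ, ∀ n : ℕ, (List.range n).map b ∈ T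

/-- The closed intervals, coded by their end points, of the `n`-th step in the construction of the
fat Cantor set: start from `[0,1]` and in step `n + 1` remove from each interval the open interval
of length `4^-(n+1)` with the same midpoint. -/
def fatCantorStage : ℕ → Set (ℝ × ℝ)
  | 0 => {(0, 1)}
  | n + 1 => {I | ∃ J ∈ fatCantorStage n,
      I = (J.1, (J.1 + J.2) / 2 - (1 / 4) ^ (n + 1) / 2) ∨
      I = ((J.1 + J.2) / 2 + (1 / 4) ^ (n + 1) / 2, J.2)}

/-- The fat Cantor set (of Lebesgue measure `1/2`). -/
def fatCantor : Set ℝ :=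
  ⋂ n : ℕ, ⋃ I ∈ fatCantorStage n, Icc I.1 I.2

/-!
The Effros Borel space is standard because a closed set is determined by the basic open sets which
it meets, and, in a complete space, the families of basic open sets that arise in this way are cut
out by countably many conditions: being hit passes to larger basic sets, and to arbitrarily small
basic sets well inside a given one (`range_hitCode`).

Pure unrectifiability is coanalytic because its failure is witnessed by a `C¹` curve, coded by its
starting point and its continuous velocity, which range over a Polish space. For a fixed curve, the
intersection with a closed set is compact, so being `μH[1]`-null is a statement about finite covers
by balls (`hausdorffMeasure_one_eq_zero_iff`), and being covered by an open set is a countable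
condition on distances (`inter_range_subset_iff`).

To a tree `T` is attached the closure `treeClosed T` of a countable set of points `(q, v_s)`, where
`s` is a node of `T`, the vector `v_s` is the sum of `2^(-|t|) e_t` over the initial segments `t` of
`s` for orthonormal vectors `e_t`, and `q` runs over a finite set of reals that grows with `|s|` to
a dense set. Along a branch the `v_s` converge to some `v`, so that the closure contains the line
`ℝ × {v}`, hence an isometric copy of the fat Cantor set (`exists_line_subset_treeClosed`).
Conversely, the coordinates of a limit point of the set determine a set of nodes of `T`, linearly
ordered by extension; if `T` has no branch, this set has a last element, and the limit point belongs
to the set already (`closure_treePoints_subset`). So `T ↦ treeClosed T` is a Borel reduction of the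
set of trees without a branch to the purely unrectifiable closed sets, and every `Π¹₁` set reduces
to the former (`exists_measurable_mem_iff_hasBranch`).
-/

/-! ### The Effros Borel space -/

/-- A measurable space whose σ-algebra is pulled back from a standard Borel space along an injection
with Borel range is itself standard Borel. -/
theorem standardBorelSpace_of_comap {α β : Type*} [mα : MeasurableSpace α] [mβ : MeasurableSpace β]
    [StandardBorelSpace β] (f : α → β) (hf : Function.Injective f) (hr : MeasurableSet (range f))
    (hm : mα = mβ.comap f) : StandardBorelSpace α := by
  have := hr.standardBorel
  obtain ⟨τ, hb, hp⟩ := this.polish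
  let e : α ≃ range f := Equiv.ofInjective f hf
  refine ⟨τ.induced e, ?_, e.polishSpace_induced⟩
  refine @BorelSpace.mk _ (τ.induced e) _ ?_
  rw [borel_comap, ← hb.measurable_eq, hm]
  exact (MeasurableSpace.comap_comp (f := Subtype.val) (g := e)).symm

theorem measurableSet_hit {X : Type*} [TopologicalSpace X] {U : Set X} (hU : IsOpen U) :
    MeasurableSet {A : Closeds X | ((A : Set X) ∩ U).Nonempty} :=
  MeasurableSpace.measurableSet_generateFrom ⟨U, hU, rfl⟩

theorem measurable_closeds_of_hit {X Y : Type*} [TopologicalSpace X] [MeasurableSpace Y]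
    {f : Y → Closeds X} (h : ∀ U : Set X, IsOpen U →
      MeasurableSet {y | ((f y : Set X) ∩ U).Nonempty}) : Measurable f :=
  measurable_generateFrom (by rintro _ ⟨U, hU, rfl⟩; exact h U hU)

/-- The code of a closed set `A`: which sets of the fixed countable basis does `A` meet? -/
def hitCode (X : Type*) [TopologicalSpace X] [SecondCountableTopology X] (A : Closeds X) :
    countableBasis X → Prop :=
  fun i => ((A : Set X) ∩ i).Nonempty

/-- The codes of closed subsets of a complete space. The second clause says that a basic set which
is hit contains arbitrarily small basic sets, with closures inside it, which are hit. -/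
def IsHitCode (X : Type*) [MetricSpace X] [SecondCountableTopology X]
    (α : countableBasis X → Prop) : Prop :=
  (∀ i j : countableBasis X, (i : Set X) ⊆ j → α i → α j) ∧
  ∀ (i : countableBasis X) (k : ℕ), α i → ∃ j : countableBasis X,
    (closure (j : Set X) ⊆ i ∧ ∀ x ∈ (j : Set X), ∀ y ∈ (j : Set X), dist x y ≤ 1 / (k + 1)) ∧ α j

section HitCode

variable {X : Type*}

theorem nonempty_inter_iff_hitCode [TopologicalSpace X] [SecondCountableTopology X]
    (A : Closeds X) {U : Set X} (hU : IsOpen U) :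
    ((A : Set X) ∩ U).Nonempty ↔ ∃ i : countableBasis X, (i : Set X) ⊆ U ∧ hitCode X A i := by
  constructor
  · rintro ⟨x, hxA, hxU⟩
    obtain ⟨v, hv, hxv, hvU⟩ := (isBasis_countableBasis X).exists_subset_of_mem_open hxU hU
    exact ⟨⟨v, hv⟩, hvU, x, hxA, hxv⟩
  · rintro ⟨i, hi, x, hxA, hxi⟩
    exact ⟨x, hxA, hi hxi⟩

theorem hitCode_injective [TopologicalSpace X] [SecondCountableTopology X] :
    Function.Injective (hitCode X) := by
  have key : ∀ A B : Closeds X, hitCode X A = hitCode X B → (A : Set X) ⊆ B := by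
    intro A B h x hx
    by_contra hxB
    have h1 := (nonempty_inter_iff_hitCode A B.isClosed.isOpen_compl).1 ⟨x, hx, hxB⟩
    rw [h, ← nonempty_inter_iff_hitCode B B.isClosed.isOpen_compl] at h1
    obtain ⟨y, hy, hy'⟩ := h1
    exact hy' hy
  intro A B h
  exact SetLike.coe_injective ((key A B h).antisymm (key B A h.symm))

theorem isHitCode_hitCode [MetricSpace X] [SecondCountableTopology X] (A : Closeds X) :
    IsHitCode X (hitCode X A) := by
  refine ⟨fun i j hij ⟨x, hxA, hxi⟩ => ⟨x, hxA, hij hxi⟩, ?_⟩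
  rintro i k ⟨x, hxA, hxi⟩
  have hi : IsOpen (i : Set X) := isOpen_of_mem_countableBasis i.2
  obtain ⟨ε, hε, hεi⟩ := Metric.isOpen_iff.1 hi x hxi
  have hδ : 0 < min (ε / 2) (1 / (k + 1) / 2 : ℝ) := by positivity
  obtain ⟨v, hv, hxv, hvU⟩ := (isBasis_countableBasis X).exists_subset_of_mem_open
    (Metric.mem_ball_self (x := x) hδ) Metric.isOpen_ball
  refine ⟨⟨v, hv⟩, ⟨?_, ?_⟩, x, hxA, hxv⟩
  · refine (closure_mono hvU).trans (Metric.closure_ball_subset_closedBall.trans ?_)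
    refine (Metric.closedBall_subset_ball ?_).trans hεi
    exact (min_le_left _ _).trans_lt (by linarith)
  · intro y hy z hz
    have h1 := (Metric.mem_ball.1 (hvU hy)).le.trans (min_le_right _ _)
    have h2 := (Metric.mem_ball.1 (hvU hz)).le.trans (min_le_right _ _)
    calc dist y z ≤ dist y x + dist z x := dist_triangle_right _ _ _
      _ ≤ _ := by linarith

theorem range_hitCode [MetricSpace X] [CompleteSpace X] [SecondCountableTopology X] :
    range (hitCode X) = {α | IsHitCode X α} := by
  refine Subset.antisymm (by rintro _ ⟨A, rfl⟩; exact isHitCode_hitCode A) ?_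
  rintro α ⟨hmono, href⟩
  let A : Set X := {x | ∀ i : countableBasis X, x ∈ (i : Set X) → α i}
  have hA : IsClosed A := by
    rw [← isOpen_compl_iff, isOpen_iff_forall_mem_open]
    intro x hx
    simp only [A, mem_compl_iff, mem_ofPred_eq, not_forall] at hx
    obtain ⟨i, hxi, hi⟩ := hx
    exact ⟨i, fun y hy hyA => hi (hyA i hy), isOpen_of_mem_countableBasis i.2, hxi⟩
  refine ⟨⟨A, hA⟩, funext fun i => propext ⟨fun ⟨x, hx, hxi⟩ => hx i hxi, fun hi => ?_⟩⟩
  -- Refine `i` to a sequence of basic sets that shrinks to a single point of `A`.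
  choose g hg hgα using href
  let s : ℕ → {j // α j} := fun n => Nat.rec ⟨i, hi⟩ (fun k j => ⟨g j.1 k j.2, hgα j.1 k j.2⟩) n
  let V : ℕ → Set X := fun n => ((s n).1 : Set X)
  have hV : ∀ k, closure (V (k + 1)) ⊆ V k := fun k => (hg (s k).1 k (s k).2).1
  have hd : ∀ k, ∀ x ∈ V (k + 1), ∀ y ∈ V (k + 1), dist x y ≤ 1 / (k + 1) :=
    fun k => (hg (s k).1 k (s k).2).2
  have hanti : Antitone V := antitone_nat_of_succ_le fun k => subset_closure.trans (hV k)
  have hne : ∀ k, (V k).Nonempty := fun k => nonempty_of_mem_countableBasis (s k).1.2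
  choose x hx using hne
  have hcau : CauchySeq fun k => x (k + 1) := by
    refine cauchySeq_of_le_tendsto_0 (fun k : ℕ => 1 / ((k : ℝ) + 1)) ?_
      tendsto_one_div_add_atTop_nhds_zero_nat
    intro n m N hn hm
    exact hd N _ (hanti (by omega : N + 1 ≤ n + 1) (hx (n + 1))) _
      (hanti (by omega : N + 1 ≤ m + 1) (hx (m + 1)))
  obtain ⟨z, hz⟩ := cauchySeq_tendsto_of_complete hcau
  have hzV : ∀ k, z ∈ V k := fun k => hV k <| mem_closure_of_tendsto hz <|
    Filter.eventually_atTop.2 ⟨k, fun n hn => hanti (by omega : k + 1 ≤ n + 1) (hx (n + 1))⟩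
  refine ⟨z, fun j hzj => ?_, hzV 0⟩
  obtain ⟨ε, hε, hεj⟩ := Metric.isOpen_iff.1 (isOpen_of_mem_countableBasis j.2) z hzj
  obtain ⟨k, hk⟩ := exists_nat_one_div_lt hε
  exact hmono (s (k + 1)).1 j
    (fun y hy => hεj ((hd k y hy z (hzV (k + 1))).trans_lt hk)) (s (k + 1)).2

theorem measurableSet_isHitCode [MetricSpace X] [SecondCountableTopology X] :
    MeasurableSet {α | IsHitCode X α} := by
  have : Countable (countableBasis X) := (countable_countableBasis X).to_subtype
  have h : ∀ i, Measurable fun α : countableBasis X → Prop => α i := measurable_pi_apply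
  refine measurableSet_setOfPred.2 (Measurable.and ?_ ?_)
  · exact Measurable.forall fun i => Measurable.forall fun j =>
      measurable_const.imp ((h i).imp (h j))
  · exact Measurable.forall fun i => Measurable.forall fun k =>
      (h i).imp (Measurable.exists fun j => measurable_const.and (h j))

theorem effros_eq_comap_hitCode [TopologicalSpace X] [SecondCountableTopology X] :
    effrosMeasurableSpace X = MeasurableSpace.comap (hitCode X) inferInstance := by
  have : Countable (countableBasis X) := (countable_countableBasis X).to_subtype
  apply le_antisymm
  · refine MeasurableSpace.generateFrom_le ?_
    rintro _ ⟨U, hU, rfl⟩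
    refine ⟨{α | ∃ i : countableBasis X, (i : Set X) ⊆ U ∧ α i}, ?_, ?_⟩
    · exact measurableSet_setOfPred.2
        (Measurable.exists fun i => measurable_const.and (measurable_pi_apply i))
    · ext A
      exact (nonempty_inter_iff_hitCode A hU).symm
  · rw [← measurable_iff_comap_le]
    exact measurable_pi_lambda _ fun i =>
      measurableSet_setOfPred.1 (measurableSet_hit (isOpen_of_mem_countableBasis i.2))

/-- The Effros Borel space of a complete separable metric space is standard Borel. -/
theorem standardBorelSpace_closeds [MetricSpace X] [CompleteSpace X] [SecondCountableTopology X] :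
    StandardBorelSpace (Closeds X) :=
  have : Countable (countableBasis X) := (countable_countableBasis X).to_subtype
  standardBorelSpace_of_comap (hitCode X) hitCode_injective
    (range_hitCode (X := X) ▸ measurableSet_isHitCode) effros_eq_comap_hitCode

end HitCode

/-! ### One-dimensional Hausdorff null sets and finite covers by balls -/

/-- A compact set is `μH[1]`-null iff it has finite covers, by balls from a fixed countable family,
whose radii have arbitrarily small sum. -/
theorem hausdorffMeasure_one_eq_zero_iff {X : Type*} [MetricSpace X] [MeasurableSpace X]
    [BorelSpace X] {d : ℕ → X} (hd : DenseRange d) {K : Set X} (hK : IsCompact K) :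
    μH[1] K = 0 ↔ ∀ m : ℕ, ∃ F : Finset (ℕ × ℚ),
      ∑ p ∈ F, ENNReal.ofReal p.2 ≤ ((m : ℝ≥0∞) + 1)⁻¹ ∧
      K ⊆ ⋃ p ∈ F, Metric.ball (d p.1) p.2 := by
  classical
  constructor
  · intro h m
    set ε : ℝ≥0∞ := ((m : ℝ≥0∞) + 1)⁻¹ with hε
    have hε0 : ε ≠ 0 := by simp [hε]
    rw [Measure.hausdorffMeasure_apply] at h
    have h1 := (ENNReal.iSup_eq_zero.1 ((ENNReal.iSup_eq_zero.1 h) 1)) one_pos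
    have h2 := h1.trans_lt (ENNReal.half_pos hε0)
    simp only [iInf_lt_iff] at h2
    obtain ⟨t, hts, htd, hlt⟩ := h2
    -- Replace each set of a cover of small total diameter by a slightly larger ball of the family.
    obtain ⟨c, hc, hcs⟩ := ENNReal.exists_pos_sum_of_countable (ENNReal.half_pos
      (ENNReal.half_pos hε0).ne').ne' ℕ
    have key : ∀ n, ∃ p : ℕ × ℚ, t n ⊆ Metric.ball (d p.1) p.2 ∧
        ENNReal.ofReal p.2 ≤ (⨆ _ : (t n).Nonempty, Metric.ediam (t n) ^ (1 : ℝ)) + 2 * c n := by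
      intro n
      rcases (t n).eq_empty_or_nonempty with he | hne
      · exact ⟨(0, 0), by simp [he], by simp⟩
      obtain ⟨x, hx⟩ := hne
      have hfin : Metric.ediam (t n) ≠ ∞ := ((htd n).trans_lt ENNReal.one_lt_top).ne
      have hcn : (0 : ℝ) < c n := hc n
      obtain ⟨i, hi⟩ := hd.exists_dist_lt x hcn
      obtain ⟨q, hq1, hq2⟩ := exists_rat_btwn
        (show (Metric.ediam (t n)).toReal + c n < (Metric.ediam (t n)).toReal + 2 * c n by linarith)
      refine ⟨(i, q), fun y hy => Metric.mem_ball.2 ?_, ?_⟩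
      · have hyx : dist y x ≤ (Metric.ediam (t n)).toReal := by
          rw [dist_edist]
          exact ENNReal.toReal_mono hfin (Metric.edist_le_ediam_of_mem hy hx)
        linarith [dist_triangle y x (d i)]
      · rw [iSup_pos ⟨x, hx⟩, ENNReal.rpow_one]
        refine (ENNReal.ofReal_le_ofReal hq2.le).trans ?_
        rw [ENNReal.ofReal_add ENNReal.toReal_nonneg (by positivity), ENNReal.ofReal_toReal hfin,
          ENNReal.ofReal_mul zero_le_two]
        simp
    choose p hp hps using key
    obtain ⟨J, hJ⟩ := hK.elim_finite_subcover (fun n => Metric.ball (d (p n).1) ((p n).2 : ℝ))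
      (fun _ => Metric.isOpen_ball) (hts.trans (iUnion_mono hp))
    refine ⟨J.image p, ?_, by simpa using hJ⟩
    calc ∑ p ∈ J.image p, ENNReal.ofReal p.2 ≤ ∑ n ∈ J, ENNReal.ofReal (p n).2 :=
          Finset.sum_image_le_of_nonneg fun _ _ => zero_le
      _ ≤ ∑ n ∈ J, ((⨆ _ : (t n).Nonempty, Metric.ediam (t n) ^ (1 : ℝ)) + 2 * c n) :=
          Finset.sum_le_sum fun n _ => hps n
      _ ≤ ∑' n, ((⨆ _ : (t n).Nonempty, Metric.ediam (t n) ^ (1 : ℝ)) + 2 * c n) :=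
          ENNReal.sum_le_tsum J
      _ = (∑' n, ⨆ _ : (t n).Nonempty, Metric.ediam (t n) ^ (1 : ℝ)) + 2 * ∑' n, (c n : ℝ≥0∞) := by
          rw [ENNReal.tsum_add, ENNReal.tsum_mul_left]
      _ ≤ ε / 2 + 2 * (ε / 2 / 2) := by gcongr
      _ = ε := by rw [ENNReal.mul_div_cancel two_ne_zero ENNReal.ofNat_ne_top, ENNReal.add_halves]
  · intro h
    choose F hF hKF using h
    have hdiam : ∀ (m : ℕ) (p : F m), Metric.ediam (Metric.ball (d p.1.1) (p.1.2 : ℝ)) ≤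
        2 * ENNReal.ofReal p.1.2 := by
      intro m p
      rw [← Metric.eball_ofReal]
      exact Metric.ediam_eball_le
    have hlim : Filter.Tendsto (fun m : ℕ => 2 * ((m : ℝ≥0∞) + 1)⁻¹) Filter.atTop (nhds 0) := by
      have h1 : Filter.Tendsto (fun m : ℕ => ((m : ℝ≥0∞) + 1)⁻¹) Filter.atTop (nhds 0) := by
        have := ENNReal.tendsto_inv_nat_nhds_zero.comp (Filter.tendsto_add_atTop_nat 1)
        simpa [Function.comp_def] using this
      simpa using ENNReal.Tendsto.const_mul h1 (Or.inr ENNReal.ofNat_ne_top)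
    have := Measure.hausdorffMeasure_le_liminf_sum (ι := fun m => F m) 1 K (l := Filter.atTop)
      (fun m : ℕ => 2 * ((m : ℝ≥0∞) + 1)⁻¹) hlim
      (fun m p => Metric.ball (d p.1.1) (p.1.2 : ℝ))
      (Filter.Eventually.of_forall fun m p => (hdiam m p).trans <| by
        gcongr
        exact (Finset.single_le_sum (f := fun p : ℕ × ℚ => ENNReal.ofReal p.2)
          (fun _ _ => zero_le) p.2).trans (hF m))
      (Filter.Eventually.of_forall fun m => (hKF m).trans (by simp [iUnion_subtype]))
    refine le_antisymm (this.trans ?_) (zero_le)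
    rw [← hlim.liminf_eq]
    refine Filter.liminf_le_liminf (Filter.Eventually.of_forall fun m => ?_)
    simp only [ENNReal.rpow_one]
    calc ∑ p : F m, Metric.ediam (Metric.ball (d p.1.1) (p.1.2 : ℝ))
        ≤ ∑ p : F m, 2 * ENNReal.ofReal p.1.2 := Finset.sum_le_sum fun p _ => hdiam m p
      _ = 2 * ∑ p ∈ F m, ENNReal.ofReal p.2 := by
          rw [← Finset.mul_sum, Finset.sum_coe_sort (F m) fun p => ENNReal.ofReal p.2]
      _ ≤ _ := by gcongr; exact hF m

/-! ### Pure unrectifiability is coanalytic -/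

theorem measurable_infEDist_closeds {X : Type*} [MetricSpace X] [SecondCountableTopology X]
    [MeasurableSpace X] [BorelSpace X] :
    Measurable fun p : X × Closeds X => Metric.infEDist p.1 (p.2 : Set X) := by
  refine measurable_uncurry_of_continuous_of_measurable
    (u := fun (x : X) (A : Closeds X) => Metric.infEDist x (A : Set X))
    (fun A => Metric.continuous_infEDist) fun x => measurable_of_Iio fun r => ?_
  convert measurableSet_hit (X := X) (Metric.isOpen_eball (x := x) (ε := r)) using 1
  ext A
  simp only [mem_preimage, mem_Iio, Metric.infEDist_lt_iff, mem_ofPred_eq]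
  exact ⟨fun ⟨y, hy, h⟩ => ⟨y, hy, Metric.mem_eball'.2 h⟩,
    fun ⟨y, hy, h⟩ => ⟨y, hy, Metric.mem_eball'.1 h⟩⟩

/-- The distances to `A` and to the complement of `U` do not vanish simultaneously on the compact
curve, hence are bounded away from zero together; along a dense sequence of times this becomes a
countable condition. -/
theorem inter_range_subset_iff {X I : Type*} [MetricSpace X] [TopologicalSpace I] [CompactSpace I]
    {d : ℕ → I} (hd : DenseRange d) {γ : I → X} (hγ : Continuous γ) (A : Closeds X) {U : Set X}
    (hU : IsOpen U) :
    (A : Set X) ∩ range γ ⊆ U ↔ ∃ n : ℕ, ∀ k : ℕ, ((n : ℝ≥0∞) + 1)⁻¹ ≤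
      Metric.infEDist (γ (d k)) (A : Set X) + Metric.infEDist (γ (d k)) Uᶜ := by
  have hcont : Continuous fun t => Metric.infEDist (γ t) (A : Set X) + Metric.infEDist (γ t) Uᶜ :=
    (Metric.continuous_infEDist.comp hγ).add (Metric.continuous_infEDist.comp hγ)
  constructor
  · intro h
    have : Nonempty I := ⟨d 0⟩
    obtain ⟨t, -, ht⟩ := isCompact_univ.exists_isMinOn univ_nonempty hcont.continuousOn
    have hpos : Metric.infEDist (γ t) (A : Set X) + Metric.infEDist (γ t) Uᶜ ≠ 0 := by
      intro h0
      obtain ⟨hA, hUc⟩ := add_eq_zero.1 h0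
      rw [← Metric.mem_closure_iff_infEDist_zero, A.isClosed.closure_eq] at hA
      rw [← Metric.mem_closure_iff_infEDist_zero, hU.isClosed_compl.closure_eq] at hUc
      exact hUc (h ⟨hA, t, rfl⟩)
    obtain ⟨n, hn⟩ := ENNReal.exists_inv_nat_lt hpos
    refine ⟨n, fun k => le_trans ?_ (ht (mem_univ (d k)))⟩
    exact (ENNReal.inv_le_inv.2 le_self_add).trans hn.le
  · rintro ⟨n, hn⟩ _ ⟨hA, t, rfl⟩
    by_contra hU'
    have := isClosed_property hd (p := fun t => ((n : ℝ≥0∞) + 1)⁻¹ ≤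
      Metric.infEDist (γ t) (A : Set X) + Metric.infEDist (γ t) Uᶜ)
      (isClosed_le continuous_const hcont) hn t
    rw [Metric.infEDist_zero_of_mem hA, Metric.infEDist_zero_of_mem (mem_compl hU')] at this
    simp at this

theorem measurableSet_hausdorffMeasure_inter_range_eq_zero {X I W : Type*} [MetricSpace X]
    [SecondCountableTopology X] [MeasurableSpace X] [BorelSpace X] [TopologicalSpace I]
    [CompactSpace I] [SeparableSpace I] [Nonempty I] [MeasurableSpace W] {γ : W → I → X}
    (hγ : ∀ w, Continuous (γ w)) (hγm : ∀ t, Measurable fun w => γ w t) :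
    MeasurableSet {p : Closeds X × W | μH[1] ((p.1 : Set X) ∩ range (γ p.2)) = 0} := by
  rcases isEmpty_or_nonempty W with hW | ⟨⟨w⟩⟩
  · exact (Set.toFinite _).measurableSet
  have : Nonempty X := ⟨γ w (Classical.arbitrary I)⟩
  have hK : ∀ p : Closeds X × W, IsCompact ((p.1 : Set X) ∩ range (γ p.2)) := fun p =>
    (isCompact_range (hγ p.2)).inter_left p.1.isClosed
  have hU : ∀ F : Finset (ℕ × ℚ),
      IsOpen (⋃ p ∈ F, Metric.ball (denseSeq X p.1) (p.2 : ℝ)) := fun F =>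
    isOpen_biUnion fun _ _ => Metric.isOpen_ball
  simp only [hausdorffMeasure_one_eq_zero_iff (denseRange_denseSeq X) (hK _),
    inter_range_subset_iff (denseRange_denseSeq I) (hγ _) _ (hU _)]
  refine measurableSet_setOfPred.2 (Measurable.forall fun m => Measurable.exists fun F =>
    measurable_const.and (Measurable.exists fun n => Measurable.forall fun k => ?_))
  have hm : Measurable fun p : Closeds X × W => γ p.2 (denseSeq I k) := (hγm _).comp measurable_snd
  refine measurableSet_setOfPred.1 (measurableSet_le measurable_const (Measurable.add ?_ ?_))
  · exact measurable_infEDist_closeds.comp (hm.prodMk measurable_fst)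
  · exact Metric.continuous_infEDist.measurable.comp hm

section Curve

variable {E : Type*} [NormedAddCommGroup E] [NormedSpace ℝ E]

/-- The `C¹` curve with starting point `w.1` and velocity `w.2` (extended to all times by
constants). -/
noncomputable def primitiveCurve (w : E × C(unitInterval, E)) (t : ℝ) : E :=
  w.1 + ∫ s in (0 : ℝ)..t, w.2 (projIcc 0 1 zero_le_one s)

theorem continuous_primitiveCurve_left (t : ℝ) :
    Continuous fun w : E × C(unitInterval, E) => primitiveCurve w t := by
  refine continuous_fst.add ?_
  refine intervalIntegral.continuous_parametric_intervalIntegral_of_continuous'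
    (f := fun (w : E × C(unitInterval, E)) s => w.2 (projIcc 0 1 zero_le_one s)) ?_ 0 t
  simp only [Function.uncurry_def]
  have : Continuous (projIcc (0 : ℝ) 1 zero_le_one) := continuous_projIcc
  fun_prop

variable [CompleteSpace E]

theorem contDiff_primitiveCurve (w : E × C(unitInterval, E)) :
    ContDiff ℝ 1 (primitiveCurve w) := by
  have hc : Continuous fun s => w.2 (projIcc (0 : ℝ) 1 zero_le_one s) :=
    w.2.continuous.comp continuous_projIcc
  have hd : ∀ t, HasDerivAt (primitiveCurve w) (w.2 (projIcc (0 : ℝ) 1 zero_le_one t)) t :=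
    fun t => (intervalIntegral.integral_hasDerivAt_right (hc.intervalIntegrable _ _)
      (hc.stronglyMeasurableAtFilter _ _) hc.continuousAt).const_add _
  refine contDiff_one_iff_deriv.2 ⟨fun t => (hd t).differentiableAt, ?_⟩
  rwa [show deriv (primitiveCurve w) = _ from funext fun t => (hd t).deriv]

theorem exists_primitiveCurve_eqOn {f : ℝ → E} (hf : ContDiffOn ℝ 1 f (Icc 0 1)) :
    ∃ w, EqOn (primitiveCurve w) f (Icc 0 1) := by
  have hcont : ContinuousOn (derivWithin f (Icc 0 1)) (Icc 0 1) :=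
    hf.continuousOn_derivWithin (uniqueDiffOn_Icc zero_lt_one) le_rfl
  refine ⟨(f 0, ⟨(Icc (0 : ℝ) 1).domRestrict (derivWithin f (Icc 0 1)), hcont.domRestrict⟩), ?_⟩
  intro t ht
  have hint : ∫ s in (0 : ℝ)..t, derivWithin f (Icc 0 1) s = f t - f 0 := by
    refine intervalIntegral.integral_eq_sub_of_hasDerivAt_of_le ht.1
      (hf.continuousOn.mono (Icc_subset_Icc_right ht.2)) (fun x hx => ?_) ?_
    · have hx' : x ∈ Ioo (0 : ℝ) 1 := ⟨hx.1, hx.2.trans_le ht.2⟩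
      exact (hf.differentiableOn one_ne_zero x
        (Ioo_subset_Icc_self hx')).hasDerivWithinAt.hasDerivAt (Icc_mem_nhds hx'.1 hx'.2)
    · refine (hcont.mono ?_).intervalIntegrable
      rw [uIcc_of_le ht.1]
      exact Icc_subset_Icc_right ht.2
  have hcongr : ∫ s in (0 : ℝ)..t, derivWithin f (Icc 0 1) (projIcc (0 : ℝ) 1 zero_le_one s) =
      ∫ s in (0 : ℝ)..t, derivWithin f (Icc 0 1) s := by
    refine intervalIntegral.integral_congr fun s hs => ?_
    rw [uIcc_of_le ht.1] at hs
    simp only [projIcc_of_mem zero_le_one (show s ∈ Icc (0 : ℝ) 1 from ⟨hs.1, hs.2.trans ht.2⟩)]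
  change f 0 + ∫ s in (0 : ℝ)..t, derivWithin f (Icc 0 1) (projIcc (0 : ℝ) 1 zero_le_one s) = f t
  rw [hcongr, hint, add_sub_cancel]

theorem isPurelyUnrectifiable_iff_primitiveCurve [MeasurableSpace E] [BorelSpace E] {N : Set E} :
    IsPurelyUnrectifiable N ↔ ∀ w : E × C(unitInterval, E),
      μH[1] (N ∩ range fun t : unitInterval => primitiveCurve w t) = 0 := by
  have hr : ∀ g : ℝ → E, (range fun t : unitInterval => g t) = g '' Icc 0 1 := fun g => by
    rw [image_eq_range]
  simp only [hr]
  refine ⟨fun h w => h _ (contDiff_primitiveCurve w).contDiffOn, fun h f hf => ?_⟩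
  obtain ⟨w, hw⟩ := exists_primitiveCurve_eqOn hf
  rw [← hw.image_eq]
  exact h w

/-- The closed sets that are not purely unrectifiable form the projection of a Borel set: the
witness is a `C¹` curve, given by its starting point and its velocity. -/
theorem isPi11_isPurelyUnrectifiable {E : Type} [NormedAddCommGroup E] [NormedSpace ℝ E]
    [CompleteSpace E] [SecondCountableTopology E] [MeasurableSpace E] [BorelSpace E] :
    IsPi11 {A : Closeds E | IsPurelyUnrectifiable (A : Set E)} := by
  borelize (E × C(unitInterval, E))
  refine ⟨E × C(unitInterval, E), inferInstance, inferInstance, _, inferInstance,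
    {p | μH[1] ((p.1 : Set E) ∩ range fun t : unitInterval => primitiveCurve p.2 t) = 0}ᶜ,
    (measurableSet_hausdorffMeasure_inter_range_eq_zero
      (fun w => (contDiff_primitiveCurve w).continuous.comp continuous_subtype_val)
      fun t => (continuous_primitiveCurve_left (t : ℝ)).measurable).compl, ?_⟩
  ext A
  simp only [mem_compl_iff, mem_ofPred_eq, isPurelyUnrectifiable_iff_primitiveCurve, not_forall,
    mem_image, Prod.exists, exists_and_right, exists_eq_right]

end Curve

theorem secondCountableTopology_ell2 : SecondCountableTopology Ell2 := by
  have : SeparableSpace Ell2 := by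
    rw [← isSeparable_univ_iff]
    have hb := (HilbertBasis.ofRepr (LinearIsometryEquiv.refl ℝ Ell2)).dense_span
    have hs : IsSeparable (range (HilbertBasis.ofRepr (LinearIsometryEquiv.refl ℝ Ell2))) :=
      (countable_range _).isSeparable
    have := (hs.span (R := ℝ)).closure
    rw [← Submodule.topologicalClosure_coe, hb] at this
    simpa using this
  exact UniformSpace.secondCountable_of_separable Ell2

/-! ### The closed set attached to a tree -/

/-- The unit vector of `ℓ₂` attached to a finite sequence; these avoid the coordinate `0`. -/
noncomputable def nodeUnit (s : List ℕ) : Ell2 := lp.single 2 (Encodable.encode s + 1) (1 : ℝ)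

/-- The sum of the vectors `2^(-|t|) • nodeUnit t` over all initial segments `t` of `s`. -/
noncomputable def nodeVec (s : List ℕ) : Ell2 :=
  ∑ k ∈ Finset.range (s.length + 1), (1 / 2 : ℝ) ^ k • nodeUnit (s.take k)

/-- The points `(q, nodeVec s)`, where `s` is a node of `T` and `q` is one of the first `|s| + 1`
terms of a dense sequence of reals, written in the coordinate `0`. -/
def treePoints (T : Tr) : Set Ell2 :=
  {p | ∃ s ∈ T, ∃ i ≤ s.length, p = lp.single 2 0 (denseSeq ℝ i) + nodeVec s}

/-- The closed subset of `ℓ₂` attached to a tree. -/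
def treeClosed (T : Tr) : Closeds Ell2 := ⟨closure (treePoints T), isClosed_closure⟩

theorem nodeUnit_apply (s t : List ℕ) :
    nodeUnit s (Encodable.encode t + 1) = if s = t then 1 else 0 := by
  rw [nodeUnit, lp.single_apply, Pi.single_apply]
  simp [eq_comm]

theorem nodeVec_apply (s t : List ℕ) :
    nodeVec s (Encodable.encode t + 1) = if t <+: s then (1 / 2 : ℝ) ^ t.length else 0 := by
  have : nodeVec s (Encodable.encode t + 1) =
      ∑ k ∈ Finset.range (s.length + 1), if s.take k = t then (1 / 2 : ℝ) ^ k else 0 := by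
    rw [nodeVec, lp.coeFn_sum, Finset.sum_apply]
    refine Finset.sum_congr rfl fun k _ => ?_
    rw [lp.coeFn_smul, Pi.smul_apply, nodeUnit_apply]
    simp
  rw [this]
  split_ifs with h
  · rw [Finset.sum_eq_single t.length]
    · rw [if_pos (List.prefix_iff_eq_take.1 h).symm]
    · intro k hk hne
      refine if_neg fun hk' => hne ?_
      have := congrArg List.length hk'
      rw [List.length_take] at this
      have := Finset.mem_range.1 hk
      omega
    · intro hn
      exact absurd (Finset.mem_range.2 (Nat.lt_succ_of_le h.length_le)) hn
  · exact Finset.sum_eq_zero fun k _ => if_neg fun hk : s.take k = t =>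
      h (hk ▸ List.take_prefix k s)

theorem countable_treePoints (T : Tr) : (treePoints T).Countable := by
  refine (countable_range fun p : List ℕ × ℕ =>
    (lp.single 2 0 (denseSeq ℝ p.2) + nodeVec p.1 : Ell2)).mono ?_
  rintro _ ⟨s, -, i, -, rfl⟩
  exact ⟨(s, i), rfl⟩

theorem measurable_treeClosed : Measurable treeClosed := by
  refine measurable_closeds_of_hit fun U hU => ?_
  have : {T : Tr | ((treeClosed T : Set Ell2) ∩ U).Nonempty} = {T : Tr | ∃ s : List ℕ, ∃ i : ℕ,
      s ∈ T ∧ (i ≤ s.length ∧ (lp.single 2 0 (denseSeq ℝ i) + nodeVec s : Ell2) ∈ U)} := by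
    ext T
    change (closure (treePoints T) ∩ U).Nonempty ↔ _
    rw [closure_inter_open_nonempty_iff hU]
    constructor
    · rintro ⟨_, ⟨s, hs, i, hi, rfl⟩, hU⟩
      exact ⟨s, i, hs, hi, hU⟩
    · rintro ⟨s, i, hs, hi, hU⟩
      exact ⟨_, ⟨s, hs, i, hi, rfl⟩, hU⟩
  rw [this]
  exact measurableSet_setOfPred.2 (Measurable.exists fun s => Measurable.exists fun i =>
    ((measurable_set_mem s).comp measurable_subtype_coe).and measurable_const)

/-- If every node of a set `S` of nodes of `T` has an immediate successor in `S`, then `T` has a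
branch. -/
theorem hasBranch_of_forall_exists_append {T : Tr} {S : Set (List ℕ)} (h0 : [] ∈ S)
    (hST : ∀ t ∈ S, t ∈ T) (h : ∀ t ∈ S, ∃ a, t ++ [a] ∈ S) : HasBranch T := by
  choose a ha using h
  let t : ℕ → S := fun n => Nat.rec ⟨[], h0⟩ (fun _ u => ⟨u.1 ++ [a u.1 u.2], ha u.1 u.2⟩) n
  have ht : ∀ n, (List.range n).map (fun k => a (t k).1 (t k).2) = (t n).1 := by
    intro n
    induction n with
    | zero => rfl
    | succ n ih => rw [List.range_succ, List.map_append, ih]; rfl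
  exact ⟨fun k => a (t k).1 (t k).2, fun n => ht n ▸ hST _ (t n).2⟩

/-- For a tree without branches no closure is needed: the coordinates of a limit point determine
its set of nodes, which has a last element `t`, and all nearby points of the set then come from the
node `t` itself, which contributes finitely many of them. -/
theorem closure_treePoints_subset {T : Tr} (hT : ¬ HasBranch T) :
    closure (treePoints T) ⊆ treePoints T := by
  intro y hy
  -- `t ∈ S` iff `t` is an initial segment of the node of every point of `treePoints T` that is
  -- close enough to `y`, in terms of the length of `t`.
  let S : Set (List ℕ) := {t | (1 / 2 : ℝ) ^ t.length / 2 < y (Encodable.encode t + 1)}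
  have hS : ∀ (t s : List ℕ) (x : ℝ),
      dist y (lp.single 2 0 x + nodeVec s : Ell2) < (1 / 2 : ℝ) ^ t.length / 2 →
      (t <+: s ↔ t ∈ S) := by
    intro t s x hd
    have h1 : |y (Encodable.encode t + 1) - nodeVec s (Encodable.encode t + 1)| <
        (1 / 2 : ℝ) ^ t.length / 2 := by
      refine lt_of_le_of_lt ?_ (dist_eq_norm y _ ▸ hd)
      have := lp.norm_apply_le_norm two_ne_zero (y - (lp.single 2 0 x + nodeVec s : Ell2))
        (Encodable.encode t + 1)
      simpa [lp.single_apply] using this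
    rw [nodeVec_apply, abs_lt] at h1
    change _ ↔ (1 / 2 : ℝ) ^ t.length / 2 < y (Encodable.encode t + 1)
    split_ifs at h1 with hp
    · exact iff_of_true hp (by linarith)
    · exact iff_of_false hp (by linarith)
  have happrox : ∀ t : List ℕ, ∃ s ∈ T, t <+: s ↔ t ∈ S := by
    intro t
    obtain ⟨_, ⟨s, hs, i, -, rfl⟩, hd⟩ := Metric.mem_closure_iff.1 hy
      ((1 / 2 : ℝ) ^ t.length / 2) (by positivity)
    exact ⟨s, hs, hS t s _ hd⟩
  have hST : ∀ t ∈ S, t ∈ T := by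
    intro t ht
    obtain ⟨s, hs, h⟩ := happrox t
    exact Descriptive.Tree.mem_of_prefix (h.2 ht) hs
  have h0 : [] ∈ S := by
    obtain ⟨s, -, h⟩ := happrox []
    exact h.1 s.nil_prefix
  have hmax : ∃ t ∈ S, ∀ a, t ++ [a] ∉ S := by
    by_contra! h
    exact hT (hasBranch_of_forall_exists_append h0 hST h)
  obtain ⟨t, htS, ht⟩ := hmax
  let F : Set Ell2 := (fun i => lp.single 2 0 (denseSeq ℝ i) + nodeVec t) '' Iic t.length
  have hF : IsClosed F := ((finite_Iic _).image _).isClosed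
  have hyF : y ∈ F := by
    rw [← hF.closure_eq, Metric.mem_closure_iff]
    intro ε hε
    obtain ⟨p, ⟨s, hs, i, hi, rfl⟩, hd⟩ := Metric.mem_closure_iff.1 hy
      (min ε ((1 / 2 : ℝ) ^ (t.length + 1) / 2)) (by positivity)
    have hd' := hd.trans_le (min_le_right _ _)
    have hts : t <+: s := by
      refine (hS t s _ (hd'.trans_le ?_)).2 htS
      rw [pow_succ]
      have : (0 : ℝ) < (1 / 2) ^ t.length := by positivity
      linarith
    obtain ⟨u, rfl⟩ := hts
    cases u with
    | nil =>
      rw [List.append_nil] at hi hd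
      exact ⟨_, ⟨i, hi, rfl⟩, hd.trans_le (min_le_left _ _)⟩
    | cons a u =>
      refine absurd ((hS (t ++ [a]) (t ++ a :: u) (denseSeq ℝ i) ?_).1 ⟨u, by simp⟩) (ht a)
      rwa [List.length_append]
  obtain ⟨i, hi, rfl⟩ := hyF
  exact ⟨t, hST t htS, i, hi, rfl⟩

theorem countable_treeClosed {T : Tr} (hT : ¬ HasBranch T) : (treeClosed T : Set Ell2).Countable :=
  (countable_treePoints T).mono (closure_treePoints_subset hT)

theorem isometry_single_add (v : Ell2) : Isometry fun x : ℝ => (lp.single 2 0 x + v : Ell2) :=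
  (IsometryEquiv.addRight v).isometry.comp (lp.isometry_single (E := fun _ : ℕ => ℝ) (p := 2) 0)

/-- Along a branch the vectors `nodeVec` converge, and the closed set attached to the tree contains
a line. -/
theorem exists_line_subset_treeClosed {T : Tr} (hT : HasBranch T) :
    ∃ v : Ell2, ∀ x : ℝ, (lp.single 2 0 x + v : Ell2) ∈ treeClosed T := by
  obtain ⟨b, hb⟩ := hT
  let g : ℕ → Ell2 := fun k => (1 / 2 : ℝ) ^ k • nodeUnit ((List.range k).map b)
  have hg : Summable g := by
    refine Summable.of_norm_bounded summable_geometric_two fun k => ?_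
    rw [norm_smul, nodeUnit, lp.norm_single two_pos]
    simp
  have hsum : ∀ n, ∑ k ∈ Finset.range (n + 1), g k = nodeVec ((List.range n).map b) := by
    intro n
    rw [nodeVec, List.length_map, List.length_range]
    refine Finset.sum_congr rfl fun k hk => ?_
    rw [← List.map_take, List.take_range, min_eq_left (Nat.lt_succ_iff.1 (Finset.mem_range.1 hk))]
  have hlim := hg.hasSum.tendsto_sum_nat.comp (Filter.tendsto_add_atTop_nat 1)
  refine ⟨∑' k, g k, fun x => ?_⟩
  have hc : IsClosed {x : ℝ | (lp.single 2 0 x + ∑' k, g k : Ell2) ∈ (treeClosed T : Set Ell2)} :=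
    (treeClosed T).isClosed.preimage (isometry_single_add (∑' k, g k)).continuous
  refine isClosed_property (denseRange_denseSeq ℝ) hc (fun i => ?_) x
  refine mem_closure_of_tendsto (hlim.const_add _) (Filter.eventually_atTop.2 ⟨i, fun n hn => ?_⟩)
  exact ⟨_, hb n, i, by simpa using hn, by rw [Function.comp_apply, hsum]⟩

/-! ### The fat Cantor set has positive measure -/

theorem fatCantorStage_finite_ncard (n : ℕ) :
    (fatCantorStage n).Finite ∧ (fatCantorStage n).ncard ≤ 2 ^ n := by
  induction n with
  | zero => simp [fatCantorStage]
  | succ n ih =>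
    let l : ℝ × ℝ → ℝ × ℝ := fun J => (J.1, (J.1 + J.2) / 2 - (1 / 4) ^ (n + 1) / 2)
    let r : ℝ × ℝ → ℝ × ℝ := fun J => ((J.1 + J.2) / 2 + (1 / 4) ^ (n + 1) / 2, J.2)
    have : fatCantorStage (n + 1) = l '' fatCantorStage n ∪ r '' fatCantorStage n := by
      ext I
      constructor
      · rintro ⟨J, hJ, h | h⟩
        · exact Or.inl ⟨J, hJ, h.symm⟩
        · exact Or.inr ⟨J, hJ, h.symm⟩
      · rintro (⟨J, hJ, h⟩ | ⟨J, hJ, h⟩)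
        · exact ⟨J, hJ, Or.inl h.symm⟩
        · exact ⟨J, hJ, Or.inr h.symm⟩
    rw [this]
    refine ⟨(ih.1.image _).union (ih.1.image _), (ncard_union_le _ _).trans ?_⟩
    have h1 := ncard_image_le (f := l) ih.1
    have h2 := ncard_image_le (f := r) ih.1
    have h3 := ih.2
    omega

/-- The union of the open intervals removed from the stage `n`. -/
def fatCantorGaps (n : ℕ) : Set ℝ :=
  ⋃ J ∈ fatCantorStage n,
    Ioo ((J.1 + J.2) / 2 - (1 / 4) ^ (n + 1) / 2) ((J.1 + J.2) / 2 + (1 / 4) ^ (n + 1) / 2)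

theorem Icc_subset_fatCantor_union : Icc (0 : ℝ) 1 ⊆ fatCantor ∪ ⋃ n, fatCantorGaps n := by
  intro x hx
  by_contra h
  simp only [mem_union, mem_iUnion, not_or, not_exists] at h
  refine h.1 (mem_iInter.2 fun n => ?_)
  induction n with
  | zero => simpa [fatCantorStage] using hx
  | succ n ih =>
    obtain ⟨J, hJ, hxJ⟩ := mem_iUnion₂.1 ih
    have hgap := h.2 n
    simp only [fatCantorGaps, mem_iUnion, not_exists] at hgap
    have hgap := hgap J hJ
    rw [mem_Ioo, not_and_or, not_lt, not_lt] at hgap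
    rcases hgap with hl | hr
    · exact mem_iUnion₂.2 ⟨_, ⟨J, hJ, Or.inl rfl⟩, hxJ.1, hl⟩
    · exact mem_iUnion₂.2 ⟨_, ⟨J, hJ, Or.inr rfl⟩, hr, hxJ.2⟩

theorem volume_fatCantorGaps_le (n : ℕ) :
    volume (fatCantorGaps n) ≤ ENNReal.ofReal (1 / 4 * (1 / 2) ^ n) := by
  obtain ⟨hfin, hcard⟩ := fatCantorStage_finite_ncard n
  have : fatCantorGaps n = ⋃ J ∈ hfin.toFinset,
      Ioo ((J.1 + J.2) / 2 - (1 / 4) ^ (n + 1) / 2) ((J.1 + J.2) / 2 + (1 / 4) ^ (n + 1) / 2) := by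
    simp [fatCantorGaps]
  rw [this]
  refine (measure_biUnion_finset_le _ _).trans ?_
  have hvol : ∀ c d : ℝ, volume (Ioo (c - d / 2) (c + d / 2)) = ENNReal.ofReal d := fun c d => by
    rw [Real.volume_Ioo]; ring_nf
  simp only [hvol, Finset.sum_const, ← ncard_eq_toFinset_card _ hfin]
  rw [nsmul_eq_mul, ← ENNReal.ofReal_natCast, ← ENNReal.ofReal_mul (by positivity)]
  apply ENNReal.ofReal_le_ofReal
  calc ((fatCantorStage n).ncard : ℝ) * (1 / 4) ^ (n + 1) ≤ 2 ^ n * (1 / 4) ^ (n + 1) := by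
        gcongr; exact_mod_cast hcard
    _ = 1 / 4 * (1 / 2) ^ n := by
        rw [pow_succ, ← mul_assoc, ← mul_pow]; norm_num [mul_comm]

theorem volume_fatCantor_pos : 0 < volume fatCantor := by
  have hgaps : volume (⋃ n, fatCantorGaps n) ≤ ENNReal.ofReal (1 / 2) := by
    refine (measure_iUnion_le _).trans ((ENNReal.tsum_le_tsum volume_fatCantorGaps_le).trans ?_)
    rw [← ENNReal.ofReal_tsum_of_nonneg (fun n => by positivity)
      (summable_geometric_two.mul_left _), tsum_mul_left, tsum_geometric_two]
    norm_num
  by_contra h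
  have h0 : volume fatCantor = 0 := by simpa using h
  have h1 := (measure_mono Icc_subset_fatCantor_union).trans (measure_union_le (μ := volume) _ _)
  rw [h0, zero_add, Real.volume_Icc] at h1
  have h2 := (ENNReal.ofReal_le_ofReal_iff (by norm_num)).1 (h1.trans hgaps)
  norm_num at h2

theorem fatCantor_subset_Icc : fatCantor ⊆ Icc 0 1 := fun x hx => by
  simpa [fatCantorStage] using mem_iInter.1 hx 0

/-! ### Reduction of analytic sets to trees with a branch -/

theorem IsSigma11.analyticSet {X : Type*} [TopologicalSpace X] [PolishSpace X] [MeasurableSpace X]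
    [BorelSpace X] {A : Set X} (hA : IsSigma11 A) : AnalyticSet A := by
  obtain ⟨Y, _, _, _, _, B, hB, rfl⟩ := hA
  exact hB.analyticSet.image_of_continuous continuous_fst

/-- For a continuous `g` on the Baire space with range `A`, the tree attached to `y` consists of the
finite sequences `s` for which `y` lies in the closure of the image under `g` of the cylinder
of `s`. Its branches are exactly the `b` with `g b = y`. -/
theorem exists_measurable_mem_iff_hasBranch {X : Type*} [TopologicalSpace X] [PolishSpace X]
    [MeasurableSpace X] [BorelSpace X] {A : Set X} (hA : AnalyticSet A) :
    ∃ Φ : X → Tr, Measurable Φ ∧ ∀ y, y ∈ A ↔ HasBranch (Φ y) := by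
  rw [AnalyticSet] at hA
  rcases hA with rfl | ⟨g, hg, rfl⟩
  · refine ⟨fun _ => ⊥, measurable_const, fun y => iff_of_false (notMem_empty y) ?_⟩
    rintro ⟨b, hb⟩
    exact Descriptive.Tree.tree_eq_bot.1 rfl (hb 0)
  let cyl : List ℕ → Set (ℕ → ℕ) := fun s => {b | (List.range s.length).map b = s}
  have hcyl : ∀ s a, cyl (s ++ [a]) ⊆ cyl s := by
    intro s a b hb
    change (List.range (s ++ [a]).length).map b = s ++ [a] at hb
    rw [List.length_append, List.length_singleton, List.range_succ, List.map_append] at hb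
    exact (List.append_inj hb (by simp)).1
  refine ⟨fun y => ⟨{s | y ∈ closure (g '' cyl s)},
    fun s a h => closure_mono (image_mono (hcyl s a)) h⟩, ?_, fun y => ⟨?_, ?_⟩⟩
  · refine Measurable.subtype_mk (measurable_set_iff.2 fun s => ?_)
    exact measurableSet_setOfPred.1 isClosed_closure.measurableSet
  · rintro ⟨b, rfl⟩
    exact ⟨b, fun n => subset_closure ⟨b, by simp [cyl], rfl⟩⟩
  · rintro ⟨b, hb⟩
    refine ⟨b, ?_⟩
    by_contra hne
    obtain ⟨V, hV, hVc, hVy⟩ := exists_mem_nhds_isClosed_subset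
      (isOpen_compl_singleton.mem_nhds (show g b ∈ ({y}ᶜ : Set X) from hne))
    obtain ⟨O, hOV, hO, hbO⟩ := mem_nhds_iff.1 (hg.continuousAt hV)
    obtain ⟨_, ⟨x, n, rfl⟩, hbn, hn⟩ :=
      (PiNat.isTopologicalBasis_cylinders fun _ : ℕ => ℕ).exists_subset_of_mem_open hbO hO
    refine hVy (closure_minimal ?_ hVc (hb n)) rfl
    rintro _ ⟨c, hc, rfl⟩
    refine hOV (hn fun i hi => ?_)
    have hc' : (List.range n).map c = (List.range n).map b := by simpa [cyl] using hc
    rw [List.map_inj_left.1 hc' i (List.mem_range.2 hi)]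
    exact hbn i hi

/-! ### Completeness of the set of purely unrectifiable closed sets -/

theorem hausdorffMeasure_image_fatCantor_pos (v : Ell2) :
    0 < μH[1] ((fun x : ℝ => (lp.single 2 0 x + v : Ell2)) '' fatCantor) := by
  rw [(isometry_single_add v).hausdorffMeasure_image (Or.inl zero_le_one), hausdorffMeasure_real]
  exact volume_fatCantor_pos

theorem contDiff_single_add (v : Ell2) :
    ContDiff ℝ 1 fun x : ℝ => (lp.single 2 0 x + v : Ell2) :=
  (lp.singleContinuousLinearMap ℝ (fun _ : ℕ => ℝ) 2 0).contDiff.add contDiff_const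

theorem isPurelyUnrectifiable_treeClosed_iff (T : Tr) :
    IsPurelyUnrectifiable (treeClosed T : Set Ell2) ↔ ¬ HasBranch T := by
  constructor
  · intro h hT
    obtain ⟨v, hv⟩ := exists_line_subset_treeClosed hT
    refine (hausdorffMeasure_image_fatCantor_pos v).ne'
      (measure_mono_null ?_ (h _ (contDiff_single_add v).contDiffOn))
    refine subset_inter ?_ (image_mono fatCantor_subset_Icc)
    rintro _ ⟨x, -, rfl⟩
    exact hv x
  · intro hT f _
    have := Measure.nullSingletonClass_hausdorff Ell2 one_pos
    exact ((countable_treeClosed hT).mono inter_subset_left).measure_zero _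

theorem isPi11Hard_isPurelyUnrectifiable :
    IsPi11Hard {A : Closeds Ell2 | IsPurelyUnrectifiable (A : Set Ell2)} := by
  intro Y _ _ _ _ B hB
  obtain ⟨Φ, hΦ, h⟩ := exists_measurable_mem_iff_hasBranch (IsSigma11.analyticSet hB)
  refine ⟨fun y => treeClosed (Φ y), measurable_treeClosed.comp hΦ, fun y => ?_⟩
  rw [mem_ofPred_eq, isPurelyUnrectifiable_treeClosed_iff, ← h, notMem_compl_iff]

theorem norm_single_add_sub_single_add (v : Ell2) (x y : ℝ) :
    ‖(lp.single 2 0 x + v : Ell2) - (lp.single 2 0 y + v)‖ = |x - y| := by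
  rw [← dist_eq_norm, ← Real.dist_eq]
  exact (isometry_single_add v).dist_eq x y

theorem mainTheorem1 :
    StandardBorelSpace (Closeds Ell2) ∧
    IsPi11Complete {A : Closeds Ell2 | IsPurelyUnrectifiable (A : Set Ell2)} ∧
    ∃ H : Tr → Closeds Ell2, Measurable H ∧
      (∀ T : Tr, ¬ HasBranch T → (H T : Set Ell2).Countable) ∧
      (∀ T : Tr, HasBranch T →
        ∃ f : ℝ → Ell2, ContDiffOn ℝ 1 f (Icc 0 1) ∧
          (∃ c > (0 : ℝ), ∃ K : ℝ, ∀ x ∈ fatCantor, ∀ y ∈ fatCantor,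
            c * |x - y| ≤ ‖f x - f y‖ ∧ ‖f x - f y‖ ≤ K * |x - y|) ∧
          f '' fatCantor ⊆ (H T : Set Ell2) ∧
          0 < μH[1] (f '' fatCantor)) := by
  have := secondCountableTopology_ell2
  refine ⟨standardBorelSpace_closeds,
    ⟨isPi11_isPurelyUnrectifiable, isPi11Hard_isPurelyUnrectifiable⟩, treeClosed,
    measurable_treeClosed, fun T hT => countable_treeClosed hT, ?_⟩
  intro T hT
  obtain ⟨v, hv⟩ := exists_line_subset_treeClosed hT
  have hiso : ∀ x ∈ fatCantor, ∀ y ∈ fatCantor,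
      1 * |x - y| ≤ ‖(lp.single 2 0 x + v : Ell2) - (lp.single 2 0 y + v)‖ ∧
      ‖(lp.single 2 0 x + v : Ell2) - (lp.single 2 0 y + v)‖ ≤ 1 * |x - y| := by
    intro x _ y _
    rw [norm_single_add_sub_single_add, one_mul]
    exact ⟨le_rfl, le_rfl⟩
  refine ⟨fun x => lp.single 2 0 x + v, ?_, ?_, ?_, ?_⟩
  · exact (contDiff_single_add v).contDiffOn
  · exact ⟨1, one_pos, 1, hiso⟩
  · rintro _ ⟨x, -, rfl⟩
    exact hv x
  · have hpos := hausdorffMeasure_image_fatCantor_pos v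
    exact hpos
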